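/- Let $X$ be a locale with frame of opens $\mathcal O(X)$. **The functors.** For a presheaf of sets $P$ on $X$ and $s\in P(u)$, $t\in P(v)$ put $\epsilon_P(s,t)=\bigvee\{w\le u\wedge v : s|_w=t|_w\}$. Let $\Lambda(P)$ be the locale whose frame consists of all functions $x:\coprod_u P(u)\to\mathcal O(X)$ with $x_s\le u$ for $s\in P(u)$ and $x_s\wedge\epsilon_P(s,t)=x_t\wedge\epsilon_P(s,t)$ for all $s,t$, ordered pointwise; it lies over $X$ by $p^*(a)=(a\wedge u_s)_s$, where $s\in P(u_s)$. For a natural transformation $\alpha:P\to Q$, $\Lambda(\alpha)^*$ sends $(x_t)_t$ to $(x_{\alpha(s)})_s$. For a locale $f:Y\to X$ over $X$, $\Gamma(f)$ is the presheaf on $X$ for which $\Gamma(f)(u)$ is the set of sections of $f$ over $u$, i.e. localic maps $s:{\downarrow}u\to Y$ with $fs$ equal to the inclusion ${\downarrow}u\rightarrowtail X$; maps over $X$ act by composition. There are natural maps $\eta_P:P\to\Gamma\Lambda(P)$, $s\mapsto p_s$, where $p_s^*(x)=x_s$, and $\varepsilon_f:\Lambda\Gamma(f)\to f$, where $\varepsilon_f^*(y)=(s^*(y))_s$.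 **Complete posheaves.** A posheaf on $X$ is a sheaf $F$ on $X$ such that every $F(u)$ is a partially ordered set, every restriction map is order-preserving, and, for $s,t\in F(\bigvee_i u_i)$, $s|_{u_i}\le t|_{u_i}$ for all $i$ implies $s\le t$. Let $\mathbb DF(u)$ be the set of downsheaves of $F|_{{\downarrow}u}$ (subsheaves that are downward closed over each open), ordered by inclusion, with the evident restriction maps. The principal ideal embedding ${\downarrow}:F\to\mathbb DF$ sends $x\in F(u)$ to the downsheaf $v\mapsto\{y\in F(v): y\le x|_v\}$, $v\le u$. The posheaf $F$ is complete if ${\downarrow}$ has a left adjoint, i.e. if there is an order-preserving morphism $\sup:\mathbb DF\to F$ such that, for all $u$, $S\in\mathbb DF(u)$ and $x\in F(u)$, $\sup_u(S)\le x$ if and only if $S\subseteq{\downarrow}x$. Let $\mathfrak{CPOS}_X$ be the category of complete posheaves on $X$ and order-preserving morphisms (those $\alpha$ for which all $\alpha_u$ are order-preserving). **Complete partially ordered sheaf locales.** A complete partially ordered sheaf locale over $X$ is a local homeomorphism of locales $f:Y\to X$ together with a partial order on each $\Gamma(f)(u)$ such that 1. every $\Gamma(f)(u)$ is a complete lattice;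 2. for $v\le u$ the restriction $\Gamma(f)(u)\to\Gamma(f)(v)$ is surjective and preserves arbitrary joins and meets; 3. if $u=\bigvee_i u_i$ and $s,t\in\Gamma(f)(u)$ satisfy $s|_{u_i}\le t|_{u_i}$ for all $i$, then $s\le t$. Let $CPOLH/X$ be the category of these, a morphism from $f:Y\to X$ to $g:Z\to X$ being a localic map $\phi:Y\to Z$ over $X$ such that every map $\Gamma(f)(u)\to\Gamma(g)(u)$, $s\mapsto\phi s$, is order-preserving. **Statement.** The functors $\Lambda$ and $\Gamma$ restrict to an equivalence of categories $$\mathfrak{CPOS}_X\rightleftarrows CPOLH/X .$$ That is, there is an equivalence between these categories whose functor $\mathfrak{CPOS}_X\to CPOLH/X$ is $\Lambda$ on underlying sheaves and locales over $X$, whose functor $CPOLH/X\to\mathfrak{CPOS}_X$ sends $f$ to the sheaf $\Gamma(f)$ with the given orders, and whose unit and counit are given by $\eta$ and $\varepsilon$. -/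

import Mathlib

open CategoryTheory Opposite Order

universe u

namespace PosheafLocale

/-! ### Locales, open sublocales, local homeomorphisms -/

/-- The frame homomorphism `f^* : 𝒪(Y) → 𝒪(X)` of a localic map `f : X → Y`. -/
def pull {X Y : Locale.{u}} (f : X ⟶ Y) : FrameHom Y X :=
  Frm.Hom.hom (Quiver.Hom.unop f)

/-- The localic map with a given inverse image homomorphism. -/
def ofPull {X Y : Locale.{u}} (φ : FrameHom Y X) : X ⟶ Y :=
  Quiver.Hom.op (Frm.ofHom φ)

@[simp] theorem pull_ofPull {X Y : Locale.{u}} (φ : FrameHom Y X) : pull (ofPull φ) = φ := rfl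

@[simp] theorem pull_id (X : Locale.{u}) : pull (𝟙 X) = FrameHom.id X := rfl

@[simp] theorem pull_comp {X Y Z : Locale.{u}} (f : X ⟶ Y) (g : Y ⟶ Z) :
    pull (f ≫ g) = (pull f).comp (pull g) := rfl

theorem hom_ext {X Y : Locale.{u}} {f g : X ⟶ Y} (h : ∀ y : Y, pull f y = pull g y) : f = g :=
  Quiver.Hom.unop_inj (Frm.ext h)

/-- The opens below `a` form a frame. -/
instance iicFrame {O : Type u} [Frame O] (a : O) : Frame (Set.Iic a) :=
  .ofMinimalAxioms
    { inf_sSup_le_iSup_inf := fun x s => by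
        rw [← Subtype.coe_le_coe]
        simp only [Set.Iic.coe_inf, Set.Iic.coe_sSup, Set.Iic.coe_iSup, inf_sSup_eq]
        exact iSup₂_le fun b hb => by
          obtain ⟨c, hc, rfl⟩ := hb
          exact le_iSup₂ (f := fun (i : Set.Iic a) (_ : i ∈ s) => (x : O) ⊓ i) c hc }

/-- `x ↦ x ⊓ a`, as a frame homomorphism onto the opens below `a`. -/
def meetHom {O : Type u} [Frame O] (a : O) : FrameHom O (Set.Iic a) where
  toFun x := ⟨x ⊓ a, inf_le_right⟩
  map_inf' x y := Subtype.ext (inf_inf_distrib_right x y a)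
  map_top' := Subtype.ext (top_inf_eq a)
  map_sSup' s := Subtype.ext (by
    rw [Set.Iic.coe_sSup, Set.image_image, sSup_image]
    exact sSup_inf_eq)

/-- For `b ≤ a`: `x ↦ x ⊓ b`, from the opens below `a` to the opens below `b`. -/
def meetHomLE {O : Type u} [Frame O] {a b : O} (h : b ≤ a) :
    FrameHom (Set.Iic a) (Set.Iic b) where
  toFun x := ⟨(x : O) ⊓ b, inf_le_right⟩
  map_inf' x y := Subtype.ext (inf_inf_distrib_right (x : O) y b)
  map_top' := Subtype.ext (inf_eq_right.2 h)
  map_sSup' s := Subtype.ext (by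
    refine (sSup_inf_eq (s := Subtype.val '' s) (b := b)).trans ?_
    rw [iSup_image, Set.Iic.coe_sSup, Set.image_image, sSup_image])

/-- The open sublocale `↓a`, where `a` is an open of the locale with frame of opens `O`. -/
abbrev openSub {O : Type u} [Frame O] (a : O) : Locale.{u} := Locale.of (Set.Iic a)

/-- The inclusion of the open sublocale `↓a`. -/
def openIncl {O : Type u} [Frame O] (a : O) : openSub a ⟶ Locale.of O :=
  ofPull (X := openSub a) (Y := Locale.of O) (meetHom a)

/-- `f : Y → X` is a local homeomorphism: `Y` is covered by open sublocales on each of which `f`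
is isomorphic to the inclusion of an open sublocale of `X`. -/
def IsLocalHomeo {Y X : Locale.{u}} (f : Y ⟶ X) : Prop :=
  ∃ (ι : Type u) (y : ι → Y), (⨆ i, y i) = ⊤ ∧
    ∀ i, ∃ (a : X) (e : openSub (y i) ≅ openSub a),
      (openIncl (y i) : openSub (y i) ⟶ Y) ≫ f = e.hom ≫ (openIncl a : openSub a ⟶ X)

/-! ### The functor `Γ` of cross-sections -/

/-- Locales over the locale `X` with frame of opens `𝒪(X) = O`. -/
abbrev LocOver (O : Type u) [Frame O] := Over (Locale.of O)

section LocOver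

variable {O : Type u} [Frame O] {L M : Type u} [Frame L] [Frame M]

/-- The locale over `X` given by a frame homomorphism `p : 𝒪(X) → L`. -/
def mkOver (p : FrameHom O L) : LocOver O :=
  Over.mk (Y := Locale.of L) (ofPull (X := Locale.of L) (Y := Locale.of O) p)

/-- The map of locales over `X` given by a frame homomorphism compatible with those from `𝒪(X)`. -/
def mkOverHom {p : FrameHom O L} {q : FrameHom O M} (θ : FrameHom M L) (h : ∀ a, θ (q a) = p a) :
    mkOver p ⟶ mkOver q :=
  Over.homMk (U := mkOver p) (V := mkOver q)
    (ofPull (X := Locale.of L) (Y := Locale.of M) θ) (hom_ext h)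

/-- The inverse image homomorphism of a map of locales over `X`. -/
def overPull {p : FrameHom O L} {f : LocOver O} (φ : mkOver p ⟶ f) :
    FrameHom (f.left : Locale.{u}) L :=
  pull (X := Locale.of L) φ.left

theorem overPull_proj {p : FrameHom O L} {f : LocOver O} (φ : mkOver p ⟶ f) (a : O) :
    overPull φ (pull f.hom a) = p a :=
  congrArg (fun g : Locale.of L ⟶ Locale.of O => pull g a) (Over.w φ)

theorem mkOver_ext {p : FrameHom O L} {f : LocOver O} {φ ψ : mkOver p ⟶ f}
    (h : ∀ y, overPull φ y = overPull ψ y) : φ = ψ :=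
  Over.OverMorphism.ext (hom_ext h)

end LocOver

/-- The open inclusions `↓a ↣ X`, as a functor from `𝒪(X)` to locales over `X`. -/
def opensOver (O : Type u) [Frame O] : O ⥤ LocOver O where
  obj a := mkOver (meetHom a)
  map h := mkOverHom (meetHomLE (leOfHom h)) fun x => Subtype.ext
    (inf_assoc x _ _ |>.trans (congrArg (x ⊓ ·) (inf_eq_right.2 (leOfHom h))))
  map_id _ := mkOver_ext fun (x : Set.Iic _) => Subtype.ext (inf_eq_left.2 x.2)
  map_comp g _ := mkOver_ext fun (x : Set.Iic _) => Subtype.ext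
    (inf_assoc (x : O) _ _ |>.trans (congrArg ((x : O) ⊓ ·) (inf_eq_right.2 (leOfHom g)))).symm

/-- Continuous sections of `f : Y → X` over the open `a`: localic maps `s : ↓a → Y` for which
`f ∘ s` is the inclusion `↓a ↣ X`. -/
abbrev Sec {O : Type u} [Frame O] (f : LocOver O) (a : O) : Type u := (opensOver O).obj a ⟶ f

/-- The restriction of a section to a smaller open. -/
def Sec.res {O : Type u} [Frame O] {f : LocOver O} {a b : O} (h : b ≤ a) (s : Sec f a) : Sec f b :=
  (opensOver O).map (homOfLE h) ≫ s

/-- The functor of cross-sections, from locales over `X` to presheaves on `X`. -/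
def Gam (O : Type u) [Frame O] : LocOver O ⥤ (Oᵒᵖ ⥤ Type u) where
  obj f := (opensOver O).op ⋙ yoneda.obj f
  map φ := Functor.whiskerLeft _ (yoneda.map φ)

/-! ### The functor `Λ` -/

section Lam

variable {O : Type u} [Frame O]

/-- The set `∐ P(a)` of all sections of a presheaf, each with its domain. -/
abbrev El (P : Oᵒᵖ ⥤ Type u) : Type u := Σ a : O, P.obj (op a)

/-- `s` and `t` are both defined on `w` and have the same restriction to `w`. -/
def AgreeOn (P : Oᵒᵖ ⥤ Type u) (s t : El P) (w : O) : Prop :=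
  ∃ (hs : w ≤ s.1) (ht : w ≤ t.1), P.map (homOfLE hs).op s.2 = P.map (homOfLE ht).op t.2

/-- The join `ε_P(s, t)` of all opens on which `s` and `t` are defined and agree. -/
def eqOpen (P : Oᵒᵖ ⥤ Type u) (s t : El P) : O := sSup {w | AgreeOn P s t w}

theorem eqOpen_le_left (P : Oᵒᵖ ⥤ Type u) (s t : El P) : eqOpen P s t ≤ s.1 :=
  sSup_le fun _ h => h.1

theorem eqOpen_le_right (P : Oᵒᵖ ⥤ Type u) (s t : El P) : eqOpen P s t ≤ t.1 :=
  sSup_le fun _ h => h.2.1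

/-- The functions `x : ∐ P(a) → 𝒪(X)` with `x_s ≤ a` for `s ∈ P(a)` and
`x_s ⊓ ε_P(s, t) = x_t ⊓ ε_P(s, t)`. -/
@[ext] structure LamFrame (P : Oᵒᵖ ⥤ Type u) : Type u where
  val : El P → O
  val_le : ∀ s, val s ≤ s.1
  val_inf : ∀ s t, val s ⊓ eqOpen P s t = val t ⊓ eqOpen P s t

variable (P : Oᵒᵖ ⥤ Type u)

/-- The pointwise order. -/
instance : PartialOrder (LamFrame P) :=
  PartialOrder.lift LamFrame.val fun _ _ h => LamFrame.ext h

instance : Min (LamFrame P) :=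
  ⟨fun x y => ⟨fun s => x.val s ⊓ y.val s, fun s => inf_le_left.trans (x.val_le s), fun s t => by
    rw [inf_inf_distrib_right, x.val_inf s t, y.val_inf s t, ← inf_inf_distrib_right]⟩⟩

instance : SupSet (LamFrame P) :=
  ⟨fun A => ⟨fun s => ⨆ x ∈ A, x.val s, fun s => iSup₂_le fun x _ => x.val_le s, fun s t => by
    simp only [iSup_inf_eq]
    exact iSup_congr fun x => iSup_congr fun _ => x.val_inf s t⟩⟩

/-- Arbitrary joins and binary meets are computed pointwise. -/
instance : CompleteLattice (LamFrame P) :=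
  { completeLatticeOfSup (LamFrame P) (fun A =>
      ⟨fun x hx s => le_iSup₂ (f := fun (y : LamFrame P) (_ : y ∈ A) => y.val s) x hx,
       fun _ hy s => iSup₂_le fun _ hx => hy hx s⟩) with
    inf := fun x y => x ⊓ y
    inf_le_left := fun _ _ _ => inf_le_left
    inf_le_right := fun _ _ _ => inf_le_right
    le_inf := fun _ _ _ h k s => le_inf (h s) (k s)
    top := ⟨fun s => s.1, fun _ => le_rfl, fun s t => by
      rw [inf_eq_right.2 (eqOpen_le_left P s t), inf_eq_right.2 (eqOpen_le_right P s t)]⟩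
    le_top := fun x s => x.val_le s }

@[simp] theorem LamFrame.inf_val (x y : LamFrame P) (s : El P) :
    (x ⊓ y).val s = x.val s ⊓ y.val s := rfl

@[simp] theorem LamFrame.top_val (s : El P) : (⊤ : LamFrame P).val s = s.1 := rfl

theorem LamFrame.sSup_val (A : Set (LamFrame P)) (s : El P) :
    (sSup A).val s = ⨆ x ∈ A, x.val s := rfl

instance : Frame (LamFrame P) :=
  .ofMinimalAxioms
    { inf_sSup_le_iSup_inf := fun x A s => by
        rw [LamFrame.inf_val, LamFrame.sSup_val, inf_iSup₂_eq]
        exact iSup₂_le fun y hy =>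
          (le_iSup₂ (f := fun (b : LamFrame P) (_ : b ∈ A) => x ⊓ b) y hy) s }

/-- The frame homomorphism `p^* : 𝒪(X) → Λ(P)`, `a ↦ (a ⊓ u_s)_s`. -/
def lamProj : FrameHom O (LamFrame P) where
  toFun a := ⟨fun s => a ⊓ s.1, fun _ => inf_le_right, fun s t => by
    rw [inf_assoc, inf_assoc, inf_eq_right.2 (eqOpen_le_left P s t),
      inf_eq_right.2 (eqOpen_le_right P s t)]⟩
  map_inf' a b := LamFrame.ext (funext fun s => inf_inf_distrib_right a b s.1)
  map_top' := LamFrame.ext (funext fun s => top_inf_eq s.1)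
  map_sSup' A := LamFrame.ext (funext fun s => by
    rw [LamFrame.sSup_val, iSup_image]
    exact sSup_inf_eq)

variable {P} {Q : Oᵒᵖ ⥤ Type u}

/-- The action of a natural transformation on elements. -/
def elMap (α : P ⟶ Q) (s : El P) : El Q := ⟨s.1, α.app _ s.2⟩

theorem eqOpen_le_map (α : P ⟶ Q) (s t : El P) :
    eqOpen P s t ≤ eqOpen Q (elMap α s) (elMap α t) :=
  sSup_le_sSup fun w ⟨hs, ht, h⟩ => ⟨hs, ht, by
    have h1 := NatTrans.naturality_apply α (homOfLE hs).op s.2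
    have h2 := NatTrans.naturality_apply α (homOfLE ht).op t.2
    exact h1.symm.trans ((congrArg _ h).trans h2)⟩

/-- The frame homomorphism `Λ(α)^* : Λ(Q) → Λ(P)`, `(x_t)_t ↦ (x_{α(s)})_s`. -/
def lamMap (α : P ⟶ Q) : FrameHom (LamFrame Q) (LamFrame P) where
  toFun x := ⟨fun s => x.val (elMap α s), fun s => x.val_le (elMap α s), fun s t => by
    have h := x.val_inf (elMap α s) (elMap α t)
    rw [← inf_eq_right.2 (eqOpen_le_map α s t), ← inf_assoc, h, inf_assoc]⟩
  map_inf' _ _ := rfl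
  map_top' := rfl
  map_sSup' A := LamFrame.ext (funext fun s => by
    rw [LamFrame.sSup_val, LamFrame.sSup_val, iSup_image])

end Lam

/-- The functor `Λ` from presheaves on `X` to locales over `X`. -/
def Lam (O : Type u) [Frame O] : (Oᵒᵖ ⥤ Type u) ⥤ LocOver O where
  obj P := mkOver (lamProj P)
  map α := mkOverHom (lamMap α) fun _ => rfl
  map_id P := mkOver_ext fun (x : LamFrame P) => LamFrame.ext (funext fun s => by
    change x.val (elMap (𝟙 P) s) = x.val s
    rfl)
  map_comp {P Q R} α β := mkOver_ext fun (x : LamFrame R) => LamFrame.ext (funext fun s => by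
    change x.val (elMap (α ≫ β) s) = x.val (elMap β (elMap α s))
    rfl)

/-! ### The unit `P → ΓΛ(P)` and the counit `ΛΓ(f) → f` -/

section Unit

variable {O : Type u} [Frame O]

/-- The projection `p_s^* : Λ(P) → ↓a` at an element `s ∈ P(a)`. -/
def projHom (P : Oᵒᵖ ⥤ Type u) (s : El P) : FrameHom (LamFrame P) (Set.Iic s.1) where
  toFun x := ⟨x.val s, x.val_le s⟩
  map_inf' _ _ := rfl
  map_top' := rfl
  map_sSup' A := Subtype.ext (by
    rw [Set.Iic.coe_sSup, Set.image_image, sSup_image]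
    rfl)

/-- The section `p_s` of `Λ(P) → X` over `a` given by `s ∈ P(a)`. -/
def projSec (P : Oᵒᵖ ⥤ Type u) (s : El P) : Sec ((Lam O).obj P) s.1 :=
  mkOverHom (projHom P s) fun _ => rfl

theorem LamFrame.val_res (P : Oᵒᵖ ⥤ Type u) (x : LamFrame P) {a b : O} (h : b ≤ a)
    (s : P.obj (op a)) :
    x.val ⟨b, P.map (homOfLE h).op s⟩ = x.val ⟨a, s⟩ ⊓ b := by
  have hb : eqOpen P ⟨a, s⟩ ⟨b, P.map (homOfLE h).op s⟩ = b := by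
    refine le_antisymm (eqOpen_le_right P _ _) (le_sSup ⟨h, le_rfl, ?_⟩)
    simp
  have := x.val_inf ⟨a, s⟩ ⟨b, P.map (homOfLE h).op s⟩
  rw [hb, inf_eq_left.2 (x.val_le ⟨b, P.map (homOfLE h).op s⟩)] at this
  exact this.symm

/-- The unit `η_P : P → ΓΛ(P)`, `s ↦ p_s`. -/
def unitHom (P : Oᵒᵖ ⥤ Type u) : P ⟶ (Gam O).obj ((Lam O).obj P) where
  app a := TypeCat.ofHom fun s => projSec P ⟨a.unop, s⟩
  naturality a b h := by
    ext s
    exact mkOver_ext fun (x : LamFrame P) => Subtype.ext (LamFrame.val_res P x (leOfHom h.unop) s)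

/-- The inverse image `s^*(y)` of `y ∈ 𝒪(Y)` under a section `s` of `f : Y → X`, as an open
of `X`. -/
def secPull {f : LocOver O} (s : El ((Gam O).obj f)) (y : f.left) : O :=
  (overPull (p := meetHom s.1) (f := f) s.2 y : Set.Iic s.1)

theorem secPull_inf_of_agree (f : LocOver O) (y : f.left) (s t : El ((Gam O).obj f)) (w : O)
    (h : AgreeOn ((Gam O).obj f) s t w) : secPull s y ⊓ w = secPull t y ⊓ w := by
  obtain ⟨hs, ht, h⟩ := h
  exact congrArg (fun r => secPull (f := f) ⟨w, r⟩ y) h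

/-- The frame homomorphism `ε_f^* : 𝒪(Y) → ΛΓ(f)`, `y ↦ (s^*(y))_s`. -/
def counitPull (f : LocOver O) : FrameHom (f.left : Locale.{u}) (LamFrame ((Gam O).obj f)) where
  toFun y := ⟨fun s => secPull s y, fun s => (overPull (p := meetHom s.1) (f := f) s.2 y).2,
    fun s t => by
      simp only [eqOpen, inf_sSup_eq]
      exact iSup_congr fun w => iSup_congr fun hw => secPull_inf_of_agree f y s t w hw⟩
  map_inf' y z := LamFrame.ext (funext fun s =>
    congrArg Subtype.val (map_inf (overPull (p := meetHom s.1) (f := f) s.2) y z))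
  map_top' := LamFrame.ext (funext fun s =>
    congrArg Subtype.val (map_top (overPull (p := meetHom s.1) (f := f) s.2)))
  map_sSup' A := LamFrame.ext (funext fun s => by
    rw [LamFrame.sSup_val, iSup_image]
    refine (congrArg Subtype.val
      (map_sSup (overPull (p := meetHom s.1) (f := f) s.2) A)).trans ?_
    rw [Set.Iic.coe_sSup, Set.image_image, sSup_image]
    rfl)

/-- The counit `ε_f : ΛΓ(f) → f`. -/
def counitHom (f : LocOver O) : (Lam O).obj ((Gam O).obj f) ⟶ f :=
  Over.homMk (U := mkOver (lamProj ((Gam O).obj f)))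
    (ofPull (X := Locale.of (LamFrame ((Gam O).obj f))) (Y := f.left) (counitPull f))
    (hom_ext fun x => LamFrame.ext (funext fun s =>
      congrArg Subtype.val (overPull_proj (p := meetHom s.1) (f := f) s.2 x)))

end Unit

/-! ### Posheaves -/

/-- Presheaves of partially ordered sets on `X`: each `F(a)` is a poset and restrictions are
order-preserving. Morphisms are the natural transformations with order-preserving components. -/
abbrev OPsh (O : Type u) [Frame O] := Oᵒᵖ ⥤ PartOrd.{u}

/-- The underlying presheaf of sets. -/
abbrev forgetOrder (O : Type u) [Frame O] : OPsh O ⥤ (Oᵒᵖ ⥤ Type u) :=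
  (Functor.whiskeringRight _ _ _).obj (forget PartOrd.{u})

section Posheaf

variable {O : Type u} [Frame O]

/-- The restriction map `F(a) → F(b)` for `b ≤ a`. -/
def res (F : OPsh O) {a b : O} (h : b ≤ a) : F.obj (op a) →o F.obj (op b) :=
  (F.map (homOfLE h).op).hom

theorem res_self (F : OPsh O) {a : O} (x : F.obj (op a)) : res F le_rfl x = x := by
  simp [res]

theorem res_res (F : OPsh O) {a b c : O} (h : b ≤ a) (k : c ≤ b) (x : F.obj (op a)) :
    res F k (res F h x) = res F (k.trans h) x := by
  have : (homOfLE (k.trans h)).op = (homOfLE h).op ≫ (homOfLE k).op := rfl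
  simp [res, this]

/-- The sheaf axiom: a compatible family of sections over a cover (possibly empty) patches to
exactly one section over the join. -/
def IsSheafOn (F : OPsh O) : Prop :=
  ∀ (ι : Type u) (a : ι → O) (s : ∀ i, F.obj (op (a i))),
    (∀ i j, res F (inf_le_left : a i ⊓ a j ≤ a i) (s i) =
      res F (inf_le_right : a i ⊓ a j ≤ a j) (s j)) →
    ∃! t : F.obj (op (⨆ i, a i)), ∀ i, res F (le_iSup a i) t = s i

/-- A posheaf: a sheaf of partially ordered sets in which the order is local. -/
structure IsPosheaf (F : OPsh O) : Prop where
  isSheaf : IsSheafOn F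
  le_of_locally : ∀ (ι : Type u) (a : ι → O) (s t : F.obj (op (⨆ i, a i))),
    (∀ i, res F (le_iSup a i) s ≤ res F (le_iSup a i) t) → s ≤ t

/-- Points of `F` (morphisms from subterminal sheaves to `F`), regarded as elements of `F(a)`
with `a` the domain of the point. -/
abbrev Point (F : OPsh O) : Type u := Σ a : O, F.obj (op a)

/-- The order on points: `p ≤ q` iff `dom p ≤ dom q` and `p ≤ q|_{dom p}`. -/
def PointLE (F : OPsh O) (p q : Point F) : Prop := ∃ h : p.1 ≤ q.1, p.2 ≤ res F h q.2

/-- The action of a morphism on points. -/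
def pointMap {F G : OPsh O} (α : F ⟶ G) (p : Point F) : Point G := ⟨p.1, α.app _ p.2⟩

/-- `α ⊣ β`: the relations `α p ≤ q` and `p ≤ β q` are equivalent for all points. -/
def IsAdjoint {F G : OPsh O} (α : F ⟶ G) (β : G ⟶ F) : Prop :=
  ∀ (p : Point F) (q : Point G), PointLE G (pointMap α p) q ↔ PointLE F p (pointMap β q)

/-- A downsheaf of the restriction `F^a` of `F` to `a`, where `F^a` is regarded as the subsheaf of
`F` without sections over opens that are not below `a`. That is, a sub-presheaf of `F` living on
opens below `a`, closed under patching (so a subsheaf) and downward closed. -/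
@[ext] structure DownSheaf (F : OPsh O) (a : O) : Type u where
  carrier : ∀ b : O, Set (F.obj (op b))
  le_of_mem : ∀ {b : O} {x : F.obj (op b)}, x ∈ carrier b → b ≤ a
  res_mem : ∀ {b c : O} (h : c ≤ b) {x : F.obj (op b)}, x ∈ carrier b → res F h x ∈ carrier c
  patch_mem : ∀ (ι : Type u) (b : ι → O) (x : F.obj (op (⨆ i, b i))),
    (∀ i, res F (le_iSup b i) x ∈ carrier (b i)) → x ∈ carrier (⨆ i, b i)
  down : ∀ {b : O} {x y : F.obj (op b)}, x ≤ y → y ∈ carrier b → x ∈ carrier b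

/-- Inclusion of subsheaves. -/
instance (F : OPsh O) (a : O) : PartialOrder (DownSheaf F a) :=
  PartialOrder.lift DownSheaf.carrier fun _ _ h => DownSheaf.ext h

/-- The restriction `S ↦ S^b` of downsheaves. -/
def DownSheaf.restrict {F : OPsh O} {a b : O} (S : DownSheaf F a) : DownSheaf F b where
  carrier c := {x | x ∈ S.carrier c ∧ c ≤ b}
  le_of_mem h := h.2
  res_mem h _ hx := ⟨S.res_mem h hx.1, h.trans hx.2⟩
  patch_mem ι c x hx := ⟨S.patch_mem ι c x fun i => (hx i).1, iSup_le fun i => (hx i).2⟩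
  down h hy := ⟨S.down h hy.1, hy.2⟩

/-- The down-powersheaf `𝔻F`, with `𝔻F(a)` the set of downsheaves of `F^a`. -/
def downPower (F : OPsh O) : OPsh O where
  obj a := PartOrd.of (DownSheaf F a.unop)
  map _ := PartOrd.ofHom ⟨fun S => S.restrict, fun _ _ h c _ hx => ⟨h c hx.1, hx.2⟩⟩
  map_id _ := PartOrd.ext fun S => DownSheaf.ext (funext fun _ => Set.ext fun _ =>
    ⟨fun hx => hx.1, fun hx => ⟨hx, S.le_of_mem hx⟩⟩)
  map_comp _ k := PartOrd.ext fun _ => DownSheaf.ext (funext fun _ => Set.ext fun _ =>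
    ⟨fun hx => ⟨⟨hx.1, hx.2.trans (leOfHom k.unop)⟩, hx.2⟩, fun hx => ⟨hx.1.1, hx.2⟩⟩)

/-- The principal ideal `↓x` of `x ∈ F(a)`. -/
def principal (F : OPsh O) (hF : IsPosheaf F) {a : O} (x : F.obj (op a)) : DownSheaf F a where
  carrier b := {y | ∃ h : b ≤ a, y ≤ res F h x}
  le_of_mem h := h.1
  res_mem := by
    rintro b c k y ⟨h, hy⟩
    exact ⟨k.trans h, ((res F k).monotone hy).trans (res_res F h k x).le⟩
  patch_mem ι b y hy := ⟨iSup_le fun i => (hy i).1, hF.le_of_locally ι b _ _ fun i => by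
    rw [res_res]; exact (hy i).2⟩
  down h hy := ⟨hy.1, h.trans hy.2⟩

/-- The principal ideal embedding `↓ : F → 𝔻F`. -/
def principalHom (F : OPsh O) (hF : IsPosheaf F) : F ⟶ downPower F where
  app a := PartOrd.ofHom ⟨fun x => principal F hF (a := a.unop) x,
    fun _ _ h _ _ hz => ⟨hz.1, hz.2.trans ((res F hz.1).monotone h)⟩⟩
  naturality a b h := PartOrd.ext fun x => DownSheaf.ext (funext fun c => Set.ext fun y => by
    constructor
    · rintro ⟨k, hy⟩
      exact ⟨⟨k.trans (leOfHom h.unop), le_of_le_of_eq hy (res_res F (leOfHom h.unop) k x)⟩, k⟩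
    · rintro ⟨⟨_, hy⟩, k⟩
      exact ⟨k, le_of_le_of_eq hy (res_res F (leOfHom h.unop) k x).symm⟩)

/-- A complete posheaf: a posheaf whose principal ideal embedding `↓ : F → 𝔻F` has a left
adjoint. -/
def IsCompletePosheaf (F : OPsh O) : Prop :=
  ∃ hF : IsPosheaf F, ∃ sup : downPower F ⟶ F, IsAdjoint sup (principalHom F hF)

end Posheaf

/-- The property of being a complete posheaf on `X`. -/
def completePosheaf (O : Type u) [Frame O] : ObjectProperty (OPsh O) := fun F => IsCompletePosheaf F

/-- The category of complete posheaves on `X` and order-preserving morphisms. -/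
abbrev CPOS (O : Type u) [Frame O] := (completePosheaf O).FullSubcategory

/-- The underlying sheaf of sets of a complete posheaf. -/
abbrev CPOS.toPresheaf (O : Type u) [Frame O] : CPOS O ⥤ (Oᵒᵖ ⥤ Type u) :=
  (completePosheaf O).ι ⋙ forgetOrder O

/-! ### Complete partially ordered sheaf locales -/

/-- A complete partially ordered sheaf locale over `X`. -/
structure CPOLH (O : Type u) [Frame O] where
  /-- the locale over `X` -/
  toOver : LocOver O
  isLocalHomeo : IsLocalHomeo toOver.hom
  /-- the partial orders on the sets of sections -/
  [order : ∀ a : O, PartialOrder (Sec toOver a)]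
  /-- the sections over each open form a complete lattice -/
  exists_isLUB : ∀ (a : O) (A : Set (Sec toOver a)), ∃ s, IsLUB A s
  exists_isGLB : ∀ (a : O) (A : Set (Sec toOver a)), ∃ s, IsGLB A s
  res_surjective : ∀ {a b : O} (h : b ≤ a),
    Function.Surjective (Sec.res h : Sec toOver a → Sec toOver b)
  /-- restrictions preserve arbitrary joins -/
  res_isLUB : ∀ {a b : O} (h : b ≤ a) (A : Set (Sec toOver a)) (s : Sec toOver a),
    IsLUB A s → IsLUB (Sec.res h '' A) (Sec.res h s)
  /-- restrictions preserve arbitrary meets -/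
  res_isGLB : ∀ {a b : O} (h : b ≤ a) (A : Set (Sec toOver a)) (s : Sec toOver a),
    IsGLB A s → IsGLB (Sec.res h '' A) (Sec.res h s)
  /-- the order is local -/
  le_of_locally : ∀ (ι : Type u) (a : ι → O) (s t : Sec toOver (⨆ i, a i)),
    (∀ i, Sec.res (le_iSup a i) s ≤ Sec.res (le_iSup a i) t) → s ≤ t

attribute [instance] CPOLH.order

namespace CPOLH

variable {O : Type u} [Frame O]

/-- Maps of locales over `X` such that composition with them is order-preserving on sections over
each open. -/
@[ext] structure Hom (f g : CPOLH O) : Type u where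
  hom : f.toOver ⟶ g.toOver
  mono : ∀ (a : O) (s t : Sec f.toOver a), s ≤ t → (s ≫ hom : Sec g.toOver a) ≤ t ≫ hom

instance : Category.{u} (CPOLH O) where
  Hom := Hom
  id f := ⟨𝟙 _, fun a s t h => by simpa using h⟩
  comp φ ψ := ⟨φ.hom ≫ ψ.hom, fun a s t h => by
    simpa using ψ.mono a _ _ (φ.mono a s t h)⟩
  id_comp _ := Hom.ext (Category.id_comp _)
  comp_id _ := Hom.ext (Category.comp_id _)
  assoc _ _ _ := Hom.ext (Category.assoc _ _ _)

variable (O) in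
/-- Forgetting the orders. -/
def forget : CPOLH O ⥤ LocOver O where
  obj f := f.toOver
  map φ := φ.hom

theorem res_mono (f : CPOLH O) {a b : O} (h : b ≤ a) :
    Monotone (Sec.res h : Sec f.toOver a → Sec f.toOver b) := fun s t hst =>
  (f.res_isLUB h {s, t} t ⟨by rintro r (rfl | rfl) <;> simp [hst], fun r hr => hr (by simp)⟩).1
    ⟨s, by simp, rfl⟩

variable (O) in
/-- The functor `Γ` on complete partially ordered sheaf locales: the presheaf of sections with the
given orders. -/
def sections : CPOLH O ⥤ OPsh O where
  obj f :=
    { obj := fun a => PartOrd.of (Sec f.toOver a.unop)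
      map := fun h => PartOrd.ofHom ⟨Sec.res (leOfHom h.unop), f.res_mono (leOfHom h.unop)⟩
      map_id := fun a => PartOrd.ext fun s => by
        change (opensOver O).map (𝟙 _) ≫ s = s
        rw [CategoryTheory.Functor.map_id]
        exact Category.id_comp s
      map_comp := fun {a b c} h k => PartOrd.ext fun s => by
        change (opensOver O).map (k.unop ≫ h.unop) ≫ s =
          (opensOver O).map k.unop ≫ (opensOver O).map h.unop ≫ s
        rw [CategoryTheory.Functor.map_comp, Category.assoc] }
  map φ :=
    { app := fun a => PartOrd.ofHom ⟨fun s => s ≫ φ.hom, φ.mono a.unop⟩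
      naturality := fun a b h => PartOrd.ext fun s =>
        Category.assoc ((opensOver O).map h.unop) s φ.hom }
  map_id f := NatTrans.ext (funext fun a => PartOrd.ext fun s =>
    Category.comp_id (X := (opensOver O).obj a.unop) s)
  map_comp φ ψ := NatTrans.ext (funext fun a => PartOrd.ext fun s =>
    (Category.assoc (W := (opensOver O).obj a.unop) s φ.hom ψ.hom).symm)

end CPOLH

end PosheafLocale

/-!
For a presheaf `P`, the opens `imageOpen t = (ε(s, t))_s` with `t ∈ P(a)` cover `Λ(P)`, and below
`imageOpen t` every open is the inverse image of a unique open of `X` below `a` (`inf_imageOpen`).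
So `Λ(P)` is a local homeomorphism (`isLocalHomeo_lam`), and a section of it is locally of the form
`p_t`; if `P` is a sheaf, these local representatives patch, and the unit is bijective
(`unitHom_injective`, `unitHom_surjective`). Conversely, a local homeomorphism `f : Y → X` has local
sections with open images covering `Y` (`IsLocalHomeo.exists_sections`), so an open of `Y` is the
same thing as a compatible family of opens indexed by the sections, and the counit is an isomorphism
(`isIso_counitHom`).

It remains to compare the orders. A posheaf `F` is complete if and only if its fibres are complete
lattices and its restrictions are surjective and preserve joins and meets. Given the supremum map
on downsheaves, the join of `A ⊆ F(a)` is the supremum of the downsheaf of sections below all local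
upper bounds of `A`, and the supremum of `↓x` over a larger open is the least extension of `x`, so
that restrictions are surjective and have left adjoints
(`IsCompletePosheaf.isFiberwiseComplete`). Conversely, restrictions have left adjoints because they
preserve meets, and the supremum of a downsheaf is the join of the least extensions of its elements.
This is natural because least extensions commute with restrictions, by patching
(`IsFiberwiseComplete.res_le_of_isLeastExtension`, `IsFiberwiseComplete.isCompletePosheaf`).
Transporting the order of `F` along the unit makes `Λ(F)` an object of `CPOLH/X`, and the unit and
the counit become isomorphisms of ordered objects.
-/

namespace PosheafLocale

/-! ### `Λ(P)` is a local homeomorphism -/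

section Generators

variable {O : Type u} [Frame O] (P : Oᵒᵖ ⥤ Type u)

theorem map_map_apply {a b c : O} (h : b ≤ a) (k : c ≤ b) (s : P.obj (op a)) :
    P.map (homOfLE k).op (P.map (homOfLE h).op s) = P.map (homOfLE (k.trans h)).op s := by
  have : (homOfLE (k.trans h)).op = (homOfLE h).op ≫ (homOfLE k).op := rfl
  simp [this]

variable {P} in
theorem AgreeOn.mono {s t : El P} {v w : O} (h : AgreeOn P s t w) (hv : v ≤ w) :
    AgreeOn P s t v := by
  obtain ⟨hs, ht, h⟩ := h
  refine ⟨hv.trans hs, hv.trans ht, ?_⟩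
  rw [← map_map_apply P hs hv, h, map_map_apply]

theorem eqOpen_self (s : El P) : eqOpen P s s = s.1 :=
  le_antisymm (eqOpen_le_left P s s) (le_sSup ⟨le_rfl, le_rfl, rfl⟩)

theorem eqOpen_inf_eqOpen_le (s t r : El P) : eqOpen P s r ⊓ eqOpen P s t ≤ eqOpen P t r := by
  simp only [eqOpen, sSup_inf_sSup]
  refine iSup₂_le fun p hp => le_sSup ?_
  obtain ⟨_, h₁, e₁⟩ := hp.1.mono (inf_le_left : p.1 ⊓ p.2 ≤ p.1)
  obtain ⟨_, h₂, e₂⟩ := hp.2.mono (inf_le_right : p.1 ⊓ p.2 ≤ p.2)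
  exact ⟨h₂, h₁, e₂.symm.trans e₁⟩

theorem eqOpen_comm (s t : El P) : eqOpen P s t = eqOpen P t s :=
  congrArg sSup (Set.ext fun _ =>
    ⟨fun ⟨h, k, e⟩ => ⟨k, h, e.symm⟩, fun ⟨h, k, e⟩ => ⟨k, h, e.symm⟩⟩)

/-- The open `s ↦ ε_P(s, t)` of `Λ(P)`: the image of the section of `Λ(P)` given by `t`. -/
def imageOpen (t : El P) : LamFrame P where
  val s := eqOpen P s t
  val_le s := eqOpen_le_left P s t
  val_inf s r := le_antisymm
    (le_inf (eqOpen_inf_eqOpen_le P s r t) inf_le_right)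
    (le_inf (by rw [eqOpen_comm P s r]; exact eqOpen_inf_eqOpen_le P r s t) inf_le_right)

/-- On the image of the section `t`, an open `x` of `Λ(P)` is the inverse image of the open `x_t`
of `X`. -/
theorem inf_imageOpen (x : LamFrame P) (t : El P) :
    x ⊓ imageOpen P t = lamProj P (x.val t) ⊓ imageOpen P t :=
  LamFrame.ext (funext fun s => by
    change x.val s ⊓ eqOpen P s t = (x.val t ⊓ s.1) ⊓ eqOpen P s t
    rw [x.val_inf, inf_assoc, inf_eq_right.2 (eqOpen_le_left P s t)])

/-- The images of the sections given by the elements of `P` cover `Λ(P)`. -/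
theorem iSup_imageOpen : ⨆ t, imageOpen P t = ⊤ :=
  top_le_iff.1 fun s => by
    have h : imageOpen P s ≤ ⨆ t, imageOpen P t := le_iSup (imageOpen P) s
    exact (eqOpen_self P s).ge.trans (h s)

/-- The frame homomorphism `b ↦ p^*(b) ⊓ imageOpen t` from the opens of the domain of `t`. -/
def imageOpenHom (t : El P) : FrameHom (Set.Iic t.1) (Set.Iic (imageOpen P t)) where
  toFun a := ⟨lamProj P a.1 ⊓ imageOpen P t, Set.mem_Iic.2 inf_le_right⟩
  map_inf' a b := Subtype.ext (by
    change lamProj P (a.1 ⊓ b.1) ⊓ _ = (lamProj P a.1 ⊓ _) ⊓ (lamProj P b.1 ⊓ _)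
    rw [map_inf, inf_inf_distrib_right])
  map_top' := Subtype.ext (inf_eq_right.2 fun s =>
    le_inf (eqOpen_le_right P s t) (eqOpen_le_left P s t))
  map_sSup' A := Subtype.ext (by
    change lamProj P (sSup A : Set.Iic t.1).1 ⊓ _ = _
    rw [Set.Iic.coe_sSup, Set.Iic.coe_sSup, map_sSup, sSup_inf_eq, Set.image_image,
      Set.image_image, iSup_image, sSup_image])

/-- The frame homomorphism `x ↦ x_t` from the opens below `imageOpen t`. -/
def imageOpenInv (t : El P) : FrameHom (Set.Iic (imageOpen P t)) (Set.Iic t.1) where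
  toFun x := ⟨x.1.val t, x.1.val_le t⟩
  map_inf' _ _ := rfl
  map_top' := Subtype.ext (eqOpen_self P t)
  map_sSup' A := Subtype.ext (by
    change (sSup A : Set.Iic (imageOpen P t)).1.val t = _
    rw [Set.Iic.coe_sSup, Set.Iic.coe_sSup, LamFrame.sSup_val, Set.image_image, sSup_image,
      iSup_image])

/-- The open sublocale of `Λ(P)` given by `imageOpen P t` is isomorphic to the domain of `t`. -/
def imageOpenIso (t : El P) : openSub (imageOpen P t) ≅ openSub t.1 where
  hom := ofPull (X := openSub (imageOpen P t)) (Y := openSub t.1) (imageOpenHom P t)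
  inv := ofPull (X := openSub t.1) (Y := openSub (imageOpen P t)) (imageOpenInv P t)
  hom_inv_id := hom_ext fun (x : Set.Iic (imageOpen P t)) => Subtype.ext (by
    change lamProj P (x.1.val t) ⊓ imageOpen P t = x.1
    rw [← inf_imageOpen, inf_eq_left.2 x.2])
  inv_hom_id := hom_ext fun (a : Set.Iic t.1) => Subtype.ext (by
    change (a.1 ⊓ t.1) ⊓ eqOpen P t t = a.1
    rw [eqOpen_self, inf_assoc, inf_idem, inf_eq_left.2 a.2])

/-- `Λ(P) → X` is a local homeomorphism for every presheaf `P`. -/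
theorem isLocalHomeo_lam : IsLocalHomeo ((Lam O).obj P).hom :=
  ⟨El P, imageOpen P, iSup_imageOpen P, fun t => ⟨t.1, imageOpenIso P t, hom_ext fun (a : O) =>
    Subtype.ext (by
      change lamProj P a ⊓ imageOpen P t = lamProj P (a ⊓ t.1) ⊓ imageOpen P t
      have h : imageOpen P t ≤ lamProj P t.1 := fun s =>
        le_inf (eqOpen_le_right P s t) (eqOpen_le_left P s t)
      rw [map_inf, inf_assoc, inf_eq_right.2 h])⟩⟩

end Generators

/-! ### For a sheaf, the unit is bijective -/

section Unit

variable {O : Type u} [Frame O]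

/-- The sheaf axiom for presheaves of sets on a locale, in the form of `IsSheafOn`. -/
def IsSetSheaf (P : Oᵒᵖ ⥤ Type u) : Prop :=
  ∀ (ι : Type u) (a : ι → O) (s : ∀ i, P.obj (op (a i))),
    (∀ i j, P.map (homOfLE (inf_le_left : a i ⊓ a j ≤ a i)).op (s i) =
      P.map (homOfLE (inf_le_right : a i ⊓ a j ≤ a j)).op (s j)) →
    ∃! t : P.obj (op (⨆ i, a i)), ∀ i, P.map (homOfLE (le_iSup a i)).op t = s i

theorem IsSheafOn.isSetSheaf {F : OPsh O} (hF : IsSheafOn F) :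
    IsSetSheaf ((forgetOrder O).obj F) := hF

namespace IsSetSheaf

variable {P : Oᵒᵖ ⥤ Type u} (hP : IsSetSheaf P)
include hP

theorem eq_of_locally {ι : Type u} {a : O} {b : ι → O} (hb : ∀ i, b i ≤ a) (h : a ≤ ⨆ i, b i)
    {s t : P.obj (op a)}
    (e : ∀ i, P.map (homOfLE (hb i)).op s = P.map (homOfLE (hb i)).op t) : s = t := by
  obtain rfl : a = ⨆ i, b i := le_antisymm h (iSup_le hb)
  refine (hP ι b (fun i => P.map (homOfLE (hb i)).op t) fun i j => ?_).unique e fun _ => rfl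
  rw [map_map_apply, map_map_apply]

theorem exists_glue {ι : Type u} {a : O} {b : ι → O} (hb : ∀ i, b i ≤ a) (h : a ≤ ⨆ i, b i)
    (s : ∀ i, P.obj (op (b i)))
    (e : ∀ i j, P.map (homOfLE (inf_le_left : b i ⊓ b j ≤ b i)).op (s i) =
      P.map (homOfLE (inf_le_right : b i ⊓ b j ≤ b j)).op (s j)) :
    ∃ t : P.obj (op a), ∀ i, P.map (homOfLE (hb i)).op t = s i := by
  obtain rfl : a = ⨆ i, b i := le_antisymm h (iSup_le hb)
  exact (hP ι b s e).exists

/-- In a sheaf, `s` and `t` agree on the whole of `ε(s, t)`. -/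
theorem agreeOn_iff {s t : El P} {w : O} : AgreeOn P s t w ↔ w ≤ eqOpen P s t := by
  refine ⟨fun h => le_sSup h, fun h => AgreeOn.mono ?_ h⟩
  refine ⟨eqOpen_le_left P s t, eqOpen_le_right P s t, ?_⟩
  refine hP.eq_of_locally (ι := {w | AgreeOn P s t w}) (b := Subtype.val)
    (fun i => le_sSup i.2) (sSup_eq_iSup' _).le fun i => ?_
  obtain ⟨_, _, e⟩ := i.2
  exact (map_map_apply P _ (le_sSup i.2) s.2).trans
    (e.trans (map_map_apply P _ (le_sSup i.2) t.2).symm)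

end IsSetSheaf

theorem sec_ext {f : LocOver O} {a : O} {s t : Sec f a}
    (h : ∀ y, secPull (f := f) ⟨a, s⟩ y = secPull (f := f) ⟨a, t⟩ y) : s = t :=
  mkOver_ext fun y => Subtype.ext (h y)

/-- The frame homomorphism `f^* : 𝒪(X) → 𝒪(Y)` of a locale `f : Y → X` over `X`. -/
def basePull (f : LocOver O) : FrameHom O (f.left : Locale.{u}) := pull f.hom

theorem secPull_basePull {f : LocOver O} (s : El ((Gam O).obj f)) (b : O) :
    secPull s (basePull f b) = b ⊓ s.1 :=
  congrArg Subtype.val (overPull_proj (p := meetHom s.1) (f := f) s.2 b)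

theorem secPull_le {f : LocOver O} (s : El ((Gam O).obj f)) (y : f.left) : secPull s y ≤ s.1 :=
  (overPull (p := meetHom s.1) (f := f) s.2 y).2

theorem secPull_inf {f : LocOver O} (s : El ((Gam O).obj f)) (y z : f.left) :
    secPull s (y ⊓ z) = secPull s y ⊓ secPull s z :=
  congrArg Subtype.val (map_inf (overPull (p := meetHom s.1) (f := f) s.2) y z)

theorem secPull_top {f : LocOver O} (s : El ((Gam O).obj f)) : secPull s ⊤ = s.1 :=
  congrArg Subtype.val (map_top (overPull (p := meetHom s.1) (f := f) s.2))

theorem secPull_iSup {f : LocOver O} {ι : Sort*} (s : El ((Gam O).obj f)) (y : ι → f.left) :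
    secPull s (⨆ i, y i) = ⨆ i, secPull s (y i) := by
  refine (congrArg Subtype.val
    (map_iSup (overPull (p := meetHom s.1) (f := f) s.2) y)).trans ?_
  rw [Set.Iic.coe_iSup]
  rfl

/-- If `p_s = p_t`, then evaluating at the open `imageOpen t` gives `ε(s, t) = ε(t, t)`, which is
the whole domain. -/
theorem unitHom_injective {P : Oᵒᵖ ⥤ Type u} (hP : IsSetSheaf P) (a : O) :
    Function.Injective ((unitHom P).app (op a)) := fun s t h => by
  have h' : (imageOpen P ⟨a, t⟩).val ⟨a, s⟩ = (imageOpen P ⟨a, t⟩).val ⟨a, t⟩ :=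
    congrArg (fun r => secPull (f := (Lam O).obj P) ⟨a, r⟩ (imageOpen P ⟨a, t⟩)) h
  have h'' : a ≤ eqOpen P ⟨a, s⟩ ⟨a, t⟩ := (eqOpen_self P ⟨a, t⟩).ge.trans h'.ge
  obtain ⟨_, _, e⟩ := hP.agreeOn_iff.2 h''
  simpa using e

/-- A section `σ` of `Λ(P)` over `a` coincides with `p_t` on `w t = σ^*(imageOpen t)`. These opens
cover `a`, and the restrictions of the elements `t` to them patch to an element inducing `σ`. -/
theorem unitHom_surjective {P : Oᵒᵖ ⥤ Type u} (hP : IsSetSheaf P) (a : O) :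
    Function.Surjective ((unitHom P).app (op a)) := fun (σ : Sec ((Lam O).obj P) a) => by
  let σ' : El ((Gam O).obj ((Lam O).obj P)) := ⟨a, σ⟩
  let w (t : El P) : O := secPull σ' (imageOpen P t)
  -- `σ` and `p_t` agree on `w t`, by `inf_imageOpen`.
  have hw (t : El P) (x : LamFrame P) : secPull σ' x ⊓ w t = x.val t ⊓ w t := by
    have h := congrArg (fun x : LamFrame P => secPull σ' x) (inf_imageOpen P x t)
    refine (secPull_inf σ' x _).symm.trans (h.trans ((secPull_inf σ' _ _).trans ?_))
    refine (congrArg (· ⊓ w t) (secPull_basePull σ' (x.val t))).trans ?_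
    rw [inf_assoc, inf_eq_right.2 (secPull_le σ' _ : w t ≤ a)]
  have hwa (t) : w t ≤ a := secPull_le σ' _
  have hwt (t : El P) : w t ≤ t.1 := by
    have h := hw t ⊤
    rw [LamFrame.top_val] at h
    exact inf_eq_right.1 (h.symm.trans ((congrArg (· ⊓ w t) (secPull_top σ')).trans
      (inf_eq_right.2 (hwa t))))
  have hcov : ⨆ t, w t = a := (secPull_iSup σ' (imageOpen P)).symm.trans
    ((congrArg (secPull σ') (iSup_imageOpen P)).trans (secPull_top σ'))
  obtain ⟨s, hs⟩ := hP.exists_glue hwa hcov.ge (fun t => P.map (homOfLE (hwt t)).op t.2)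
    fun t r => by
      rw [map_map_apply, map_map_apply]
      have h : w t ⊓ w r ≤ eqOpen P t r :=
        (inf_comm _ _).le.trans ((hw t (imageOpen P r)).le.trans
          (inf_le_left))
      exact (hP.agreeOn_iff.2 h).2.2
  refine ⟨s, sec_ext fun (x : LamFrame P) => ?_⟩
  change x.val ⟨a, s⟩ = secPull σ' x
  have h₁ : x.val ⟨a, s⟩ = ⨆ t, x.val ⟨a, s⟩ ⊓ w t := by
    rw [← inf_iSup_eq, hcov, inf_eq_left.2 (x.val_le _)]
  have h₂ : secPull σ' x = ⨆ t, secPull σ' x ⊓ w t := by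
    rw [← inf_iSup_eq, hcov, inf_eq_left.2 (secPull_le σ' x)]
  rw [h₁, h₂]
  refine iSup_congr fun t => ?_
  rw [hw, ← LamFrame.val_res P x (hwa t), hs, LamFrame.val_res P x (hwt t)]

end Unit

/-! ### The sections of a locale over `X` form a sheaf -/

section Sections

variable {O : Type u} [Frame O]

theorem iSup_le_of_local {ι : Type*} {x y : O} {a : ι → O} (h : x ≤ ⨆ i, a i)
    (k : ∀ i, x ⊓ a i ≤ y) : x ≤ y := by
  rw [← inf_eq_left.2 h, inf_iSup_eq]
  exact iSup_le k

section Glue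

variable {f : LocOver O} {ι : Type u} {a : ι → O} (s : ∀ i, Sec f (a i))
  (e : ∀ i j, Sec.res (inf_le_left : a i ⊓ a j ≤ a i) (s i) = Sec.res inf_le_right (s j))

include e in
theorem secPull_inf_le_of_compatible (i j : ι) (y : f.left) :
    secPull (f := f) ⟨a i, s i⟩ y ⊓ a j ≤ secPull (f := f) ⟨a j, s j⟩ y := by
  have h : secPull (f := f) ⟨a i, s i⟩ y ⊓ (a i ⊓ a j) =
      secPull (f := f) ⟨a j, s j⟩ y ⊓ (a i ⊓ a j) :=
    congrArg (fun r => secPull (f := f) ⟨_, r⟩ y) (e i j)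
  rw [← inf_assoc, inf_eq_left.2 (secPull_le (f := f) ⟨a i, s i⟩ y)] at h
  exact h.le.trans inf_le_left

/-- The inverse image homomorphism `y ↦ ⋁ i, (s i)^*(y)` of the section obtained by patching
sections `s i` that agree on overlaps. -/
def glueHom : FrameHom (f.left : Locale.{u}) (Set.Iic (⨆ i, a i)) where
  toFun y := ⟨⨆ i, secPull (f := f) ⟨a i, s i⟩ y,
    Set.mem_Iic.2 (iSup_mono fun i => secPull_le (f := f) ⟨a i, s i⟩ y)⟩
  map_inf' y z := Subtype.ext (by
    change (⨆ i, secPull (f := f) ⟨a i, s i⟩ (y ⊓ z)) =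
      (⨆ i, secPull (f := f) ⟨a i, s i⟩ y) ⊓ (⨆ i, secPull (f := f) ⟨a i, s i⟩ z)
    simp only [secPull_inf]
    refine le_antisymm (le_inf (iSup_mono fun i => inf_le_left)
      (iSup_mono fun i => inf_le_right)) ?_
    rw [iSup_inf_iSup]
    refine iSup_le fun p => le_iSup_of_le p.2 (le_inf ?_ inf_le_right)
    exact (inf_le_inf_left _ (secPull_le (f := f) ⟨a p.2, s p.2⟩ z)).trans
      (secPull_inf_le_of_compatible s e _ _ y))
  map_top' := Subtype.ext (iSup_congr fun i => secPull_top (f := f) ⟨a i, s i⟩)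
  map_sSup' A := Subtype.ext (by
    rw [Set.Iic.coe_sSup, Set.image_image, sSup_image]
    change (⨆ i, secPull (f := f) ⟨a i, s i⟩ (sSup A)) =
      ⨆ y ∈ A, ⨆ i, secPull (f := f) ⟨a i, s i⟩ y
    simp only [sSup_eq_iSup, secPull_iSup]
    rw [iSup_comm]
    exact iSup_congr fun y => iSup_comm (f := fun i (_ : y ∈ A) => secPull (f := f) ⟨a i, s i⟩ y))

end Glue

theorem isSetSheaf_sections (f : LocOver O) : IsSetSheaf ((Gam O).obj f) := by
  intro ι a s e
  let t : Sec f (⨆ i, a i) := Over.homMk (U := mkOver (meetHom (⨆ i, a i)))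
    (ofPull (X := openSub (⨆ i, a i)) (Y := f.left) (glueHom s e)) (hom_ext fun b => Subtype.ext (by
      change (⨆ i, secPull (f := f) ⟨a i, s i⟩ (basePull f b)) = _
      refine Eq.trans (iSup_congr fun i => ?_) (inf_iSup_eq (b : O) a).symm
      exact secPull_basePull (f := f) ⟨a i, s i⟩ b))
  refine ⟨t, fun i => sec_ext fun y => ?_, fun r hr => sec_ext fun y => ?_⟩
  · change (⨆ j, secPull (f := f) ⟨a j, s j⟩ y) ⊓ a i = secPull (f := f) ⟨a i, s i⟩ y
    rw [iSup_inf_eq]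
    exact le_antisymm (iSup_le fun j => secPull_inf_le_of_compatible s e j i y)
      (le_iSup_of_le i (le_inf le_rfl (secPull_le (f := f) ⟨a i, s i⟩ y)))
  · change secPull (f := f) ⟨_, r⟩ y = ⨆ j, secPull (f := f) ⟨a j, s j⟩ y
    have h (i) : secPull (f := f) ⟨a i, s i⟩ y = secPull (f := f) ⟨_, r⟩ y ⊓ a i :=
      (congrArg (fun r => secPull (f := f) ⟨_, r⟩ y) (hr i)).symm
    simp only [h]
    rw [← inf_iSup_eq, inf_eq_left.2 (secPull_le (f := f) ⟨_, r⟩ y)]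

end Sections

/-! ### For a local homeomorphism, the counit is an isomorphism -/

section LocalHomeo

variable {O : Type u} [Frame O] {f : LocOver O}

/-- A local homeomorphism `f : Y → X` has local sections `s i` with open images `y i` covering
`Y`, on which every open is determined by its inverse image along `s i`. -/
theorem IsLocalHomeo.exists_sections (hf : IsLocalHomeo f.hom) :
    ∃ (ι : Type u) (y : ι → f.left) (s : ι → El ((Gam O).obj f)), (⨆ i, y i) = ⊤ ∧
      ∀ i z, basePull f (secPull (s i) z) ⊓ y i = z ⊓ y i := by
  obtain ⟨ι, y, hy, h⟩ := hf
  choose a e he using h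
  refine ⟨ι, y, fun i => ⟨a i, Over.homMk (U := mkOver (meetHom (a i)))
    ((e i).inv ≫ (openIncl (y i) : openSub (y i) ⟶ f.left)) ?_⟩, hy, fun i z => ?_⟩
  · refine (Category.assoc _ _ _).trans ?_
    exact (congrArg ((e i).inv ≫ ·) (he i)).trans ((Iso.inv_hom_id_assoc _ _))
  · let z' : Set.Iic (y i) := ⟨z ⊓ y i, inf_le_right⟩
    let b : Set.Iic (a i) := pull (e i).inv z'
    have h₁ := congrArg (fun g => (pull g b.1 : Set.Iic (y i)).1) (he i)
    have h₂ := congrArg (fun g => (pull g z' : Set.Iic (y i)).1) (e i).hom_inv_id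
    have h₃ : (⟨b.1 ⊓ a i, inf_le_right⟩ : Set.Iic (a i)) = b := Subtype.ext (inf_eq_left.2 b.2)
    refine h₁.trans (Eq.trans ?_ h₂)
    exact congrArg (fun c => (pull (e i).hom c : Set.Iic (y i)).1) h₃

theorem counitPull_val (y : f.left) (s : El ((Gam O).obj f)) :
    (counitPull f y).val s = secPull s y := rfl

theorem le_of_counitPull_le (hf : IsLocalHomeo f.hom) {y z : f.left}
    (h : counitPull f y ≤ counitPull f z) : y ≤ z := by
  obtain ⟨ι, w, s, hw, hz⟩ := hf.exists_sections
  refine iSup_le_of_local (a := w) (hw ▸ le_top) fun i => ?_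
  rw [← hz]
  refine (inf_le_inf_right _ (OrderHomClass.mono (basePull f) (h (s i)))).trans ?_
  exact (hz i z).le.trans inf_le_left

/-- An open `x` of `ΛΓ(f)` comes from the join of the images of the `x_{s i}` under the local
sections `s i` of `exists_sections`: every section `t` agrees with `s i` on `t^*(y i)`. -/
theorem counitPull_surjective (hf : IsLocalHomeo f.hom) : Function.Surjective (counitPull f) := by
  obtain ⟨ι, w, s, hw, hz⟩ := hf.exists_sections
  intro x
  refine ⟨⨆ i, basePull f (x.val (s i)) ⊓ w i, LamFrame.ext (funext fun t => ?_)⟩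
  rw [counitPull_val, secPull_iSup]
  have hle (i) : secPull t (w i) ≤ eqOpen ((Gam O).obj f) t (s i) := by
    have key (z : f.left) : secPull t z ⊓ secPull t (w i) =
        secPull (s i) z ⊓ secPull t (w i) := by
      rw [← secPull_inf, ← hz, secPull_inf, secPull_basePull, inf_assoc,
        inf_eq_right.2 (secPull_le t (w i))]
    have ht : secPull t (w i) ≤ t.1 := secPull_le _ _
    have hsi : secPull t (w i) ≤ (s i).1 := by
      have := key ⊤
      rw [secPull_top, secPull_top, inf_eq_right.2 ht] at this
      exact inf_eq_right.1 this.symm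
    exact le_sSup ⟨ht, hsi, sec_ext fun z => key z⟩
  have hi (i) : secPull t (basePull f (x.val (s i)) ⊓ w i) = x.val t ⊓ secPull t (w i) := by
    rw [secPull_inf, secPull_basePull, inf_assoc, inf_eq_right.2 (secPull_le t (w i)),
      ← inf_eq_right.2 (hle i), ← inf_assoc, ← inf_assoc, x.val_inf]
  simp only [hi]
  rw [← inf_iSup_eq, ← secPull_iSup, hw, secPull_top, inf_eq_left.2 (x.val_le t)]

theorem isIso_counitHom (hf : IsLocalHomeo f.hom) : IsIso (counitHom f) := by
  let e : (f.left : Locale.{u}) ≃o LamFrame ((Gam O).obj f) :=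
    { Equiv.ofBijective (counitPull f) ⟨fun y z h => le_antisymm
        (le_of_counitPull_le hf h.le) (le_of_counitPull_le hf h.ge), counitPull_surjective hf⟩ with
      map_rel_iff' := fun {y z} =>
        ⟨le_of_counitPull_le hf, fun h => OrderHomClass.mono (counitPull f) h⟩ }
  let i : f.left ≅ Locale.of (LamFrame ((Gam O).obj f)) :=
    (Frm.Iso.mk (α := f.left.unop) (β := Frm.of (LamFrame ((Gam O).obj f))) e).symm.op
  have h : IsIso ((Over.forget _).map (counitHom f)) := i.isIso_inv
  exact isIso_of_reflects_iso (counitHom f) (Over.forget _)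

end LocalHomeo

/-! ### Complete posheaves, fibrewise -/

section Complete

variable {O : Type u} [Frame O]

theorem IsSetSheaf.exists_glue_pair {P : Oᵒᵖ ⥤ Type u} (hP : IsSetSheaf P) {a b c : O}
    (hb : b ≤ a) (hc : c ≤ a) (h : a ≤ b ⊔ c) (s : P.obj (op b)) (t : P.obj (op c))
    (e : P.map (homOfLE (inf_le_left : b ⊓ c ≤ b)).op s =
      P.map (homOfLE (inf_le_right : b ⊓ c ≤ c)).op t) :
    ∃ r : P.obj (op a), P.map (homOfLE hb).op r = s ∧ P.map (homOfLE hc).op r = t := by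
  let d : ULift.{u} Bool → O := fun i => bif i.down then b else c
  let r : ∀ i, P.obj (op (d i)) := fun i => match i with
    | ⟨true⟩ => s
    | ⟨false⟩ => t
  have hd : a ≤ ⨆ i, d i := h.trans (sup_le (le_iSup d ⟨true⟩) (le_iSup d ⟨false⟩))
  have hd' : ∀ i, d i ≤ a := by
    rintro ⟨_ | _⟩
    exacts [hc, hb]
  obtain ⟨x, hx⟩ := hP.exists_glue hd' hd r (by
    rintro ⟨_ | _⟩ ⟨_ | _⟩
    · rfl
    · have h := congrArg (P.map (homOfLE (inf_comm c b).le).op) e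
      exact ((map_map_apply P inf_le_right (inf_comm c b).le t).symm.trans h.symm).trans
        (map_map_apply P inf_le_left (inf_comm c b).le s)
    · exact e
    · rfl)
  exact ⟨x, hx ⟨true⟩, hx ⟨false⟩⟩

/-- The conditions on the fibres of a posheaf that characterize completeness: each `F(a)` is a
complete lattice, and restrictions are surjective and preserve arbitrary joins and meets. -/
structure IsFiberwiseComplete (F : OPsh O) : Prop where
  exists_isLUB : ∀ (a : O) (A : Set (F.obj (op a))), ∃ s, IsLUB A s
  exists_isGLB : ∀ (a : O) (A : Set (F.obj (op a))), ∃ s, IsGLB A s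
  res_surjective : ∀ {a b : O} (h : b ≤ a), Function.Surjective (res F h)
  res_isLUB : ∀ {a b : O} (h : b ≤ a) (A : Set (F.obj (op a))) (s : F.obj (op a)),
    IsLUB A s → IsLUB (res F h '' A) (res F h s)
  res_isGLB : ∀ {a b : O} (h : b ≤ a) (A : Set (F.obj (op a))) (s : F.obj (op a)),
    IsGLB A s → IsGLB (res F h '' A) (res F h s)

/-- `y` is the smallest section over `a` whose restriction to `b` is above `x`, and this
restriction is `x` itself. -/
def IsLeastExtension (F : OPsh O) {a b : O} (h : b ≤ a) (x : F.obj (op b)) (y : F.obj (op a)) :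
    Prop :=
  res F h y = x ∧ ∀ z, x ≤ res F h z → y ≤ z

variable {F : OPsh O}

theorem IsPosheaf.le_of_cover (hF : IsPosheaf F) {ι : Type u} {a : O} {b : ι → O}
    (hb : ∀ i, b i ≤ a) (h : a ≤ ⨆ i, b i) {s t : F.obj (op a)}
    (e : ∀ i, res F (hb i) s ≤ res F (hb i) t) : s ≤ t := by
  obtain rfl : a = ⨆ i, b i := le_antisymm h (iSup_le hb)
  exact hF.le_of_locally ι b s t e

theorem isFiberwiseComplete_of_extension
    (hlub : ∀ (a : O) (A : Set (F.obj (op a))), ∃ s, IsLUB A s ∧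
      ∀ (b : O) (h : b ≤ a), IsLUB (res F h '' A) (res F h s))
    (hext : ∀ {a b : O} (h : b ≤ a) (x : F.obj (op b)), ∃ y, IsLeastExtension F h x y) :
    IsFiberwiseComplete F where
  exists_isLUB a A := (hlub a A).imp fun _ h => h.1
  exists_isGLB a A := by
    obtain ⟨s, hs, -⟩ := hlub a (lowerBounds A)
    exact ⟨s, isLUB_lowerBounds.1 hs⟩
  res_surjective h x := (hext h x).imp fun _ h => h.1
  res_isLUB {a b} h A s hs := by
    obtain ⟨t, ht, ht'⟩ := hlub a A
    exact hs.unique ht ▸ ht' b h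
  res_isGLB {a b} h A s hs := by
    refine ⟨(res F h).monotone.mem_lowerBounds_image hs.1, fun t ht => ?_⟩
    obtain ⟨y, hy, hy'⟩ := hext h t
    rw [← hy]
    exact (res F h).monotone (hs.2 fun z hz => hy' z (ht ⟨z, hz, rfl⟩))

/-- The downsheaf of sections that lie below every local upper bound of `A`. -/
def boundedDownSheaf (hF : IsPosheaf F) {a : O} (A : Set (F.obj (op a))) : DownSheaf F a where
  carrier b := {y | b ≤ a ∧ ∀ (c : O) (h : c ≤ b) (k : c ≤ a) (z : F.obj (op c)),
    (∀ x ∈ A, res F k x ≤ z) → res F h y ≤ z}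
  le_of_mem h := h.1
  res_mem h _ hx := ⟨h.trans hx.1, fun d k l z hz => by
    rw [res_res]; exact hx.2 d _ l z hz⟩
  patch_mem ι b x hx := ⟨iSup_le fun i => (hx i).1, fun c h k z hz => by
    refine hF.le_of_cover (b := fun i => c ⊓ b i) (fun i => inf_le_left)
      (by rw [← inf_iSup_eq]; exact le_inf le_rfl h) fun i => ?_
    have := (hx i).2 (c ⊓ b i) inf_le_right (inf_le_left.trans k) (res F inf_le_left z)
      fun y hy => by rw [← res_res F k inf_le_left]; exact (res F _).monotone (hz y hy)
    rw [res_res] at this ⊢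
    exact this⟩
  down h hy := ⟨hy.1, fun c k l z hz => ((res F k).monotone h).trans (hy.2 c k l z hz)⟩

/-- A downsheaf of `F^b` regarded as a downsheaf of `F^a`, for `b ≤ a`. -/
def DownSheaf.extend {a b : O} (h : b ≤ a) (S : DownSheaf F b) : DownSheaf F a where
  carrier := S.carrier
  le_of_mem hx := (S.le_of_mem hx).trans h
  res_mem := S.res_mem
  patch_mem := S.patch_mem
  down := S.down

/-- Joins are the suprema of `boundedDownSheaf`s, and the least extension of `x` is the supremum of
`↓x` regarded as a downsheaf over the larger open; naturality of `sup` gives compatibility with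
restrictions. -/
theorem IsCompletePosheaf.isFiberwiseComplete (h : IsCompletePosheaf F) :
    IsFiberwiseComplete F := by
  obtain ⟨hF, sup, hadj⟩ := h
  let σ {a : O} (S : DownSheaf F a) : F.obj (op a) := sup.app (op a) S
  have hσ {a : O} (S : DownSheaf F a) (x : F.obj (op a)) : σ S ≤ x ↔ S ≤ principal F hF x := by
    refine Iff.trans ⟨fun h => ⟨le_rfl, ?_⟩, fun ⟨_, h⟩ => ?_⟩ ((hadj ⟨a, S⟩ ⟨a, x⟩).trans
      ⟨fun ⟨_, h⟩ => ?_, fun h => ⟨le_rfl, ?_⟩⟩)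
    · exact h.trans (res_self (downPower F) (principal F hF x : DownSheaf F a)).le
    · exact h.trans (res_self F x).ge
    · exact h.trans (res_self F x).le
    · exact le_of_le_of_eq h (res_self (downPower F) (principal F hF x : DownSheaf F a)).symm
  have hres {a b : O} (h : b ≤ a) (S : DownSheaf F a) :
      res F h (σ S) = σ (S.restrict : DownSheaf F b) :=
    (NatTrans.naturality_apply sup (homOfLE h).op S).symm
  refine isFiberwiseComplete_of_extension (fun a A => ?_) fun {a b} h x => ?_
  · let S := boundedDownSheaf hF A
    have hmem {x} (hx : x ∈ A) : x ∈ S.carrier a :=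
      ⟨le_rfl, fun c k l z hz => hz x hx⟩
    have key (b : O) (h : b ≤ a) : IsLUB (res F h '' A) (res F h (σ S)) := by
      constructor
      · rintro _ ⟨x, hx, rfl⟩
        obtain ⟨_, h'⟩ := (hσ S (σ S)).1 le_rfl a (hmem hx)
        rw [res_self] at h'
        exact (res F h).monotone h'
      · intro z hz
        rw [hres, hσ]
        rintro c y ⟨hy, hc⟩
        refine ⟨hc, ?_⟩
        have := hy.2 c le_rfl hy.1 (res F hc z) fun x hx => by
          rw [← res_res F h hc]; exact (res F hc).monotone (hz ⟨x, hx, rfl⟩)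
        rwa [res_self] at this
    refine ⟨σ S, ?_, key⟩
    have h := key a le_rfl
    have hid : (res F (le_refl a) : F.obj (op a) → F.obj (op a)) = id := funext (res_self F)
    rwa [hid, Set.image_id] at h
  · have hx : ((principal F hF x).extend h).restrict = principal F hF x :=
      DownSheaf.ext (funext fun c => Set.ext fun y => ⟨fun hy => hy.1, fun hy => ⟨hy, hy.1⟩⟩)
    refine ⟨σ ((principal F hF x).extend h), ?_, fun z hz => ?_⟩
    · rw [hres, hx]
      refine le_antisymm ((hσ _ _).2 le_rfl) ?_
      obtain ⟨_, h'⟩ := (hσ (principal F hF x) _).1 le_rfl b ⟨le_rfl, (res_self F x).ge⟩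
      rwa [res_self] at h'
    · rw [hσ]
      rintro c y ⟨hc, hy⟩
      exact ⟨hc.trans h, hy.trans (((res F hc).monotone hz).trans (res_res F h hc z).le)⟩

/-- The least extension of `x` is the meet of all sections whose restriction is above `x`. -/
theorem IsFiberwiseComplete.exists_isLeastExtension (h : IsFiberwiseComplete F) {a b : O}
    (k : b ≤ a) (x : F.obj (op b)) : ∃ y, IsLeastExtension F k x y := by
  obtain ⟨y, hy⟩ := h.exists_isGLB a {z | x ≤ res F k z}
  refine ⟨y, le_antisymm ?_ ?_, fun z hz => hy.1 hz⟩
  · obtain ⟨z, rfl⟩ := h.res_surjective k x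
    exact (res F k).monotone (hy.1 (le_refl (res F k z)))
  · exact (h.res_isGLB k _ y hy).2 (by rintro _ ⟨z, hz, rfl⟩; exact hz)

/-- For `b, c ≤ a`, the least extension `y` of `x ∈ F(b)` to `a` lies on `c` below the least
extension of `x|_{b ⊓ c}` to `c`, hence below every `m ∈ F(c)` with `x|_{b ⊓ c} ≤ m|_{b ⊓ c}`. It
holds because `x` and the extension over `c` patch to a section over `b ⊔ c`, which
extends to `a`. -/
theorem IsFiberwiseComplete.res_le_of_isLeastExtension (h : IsFiberwiseComplete F)
    (hF : IsPosheaf F) {a b c : O} (hb : b ≤ a) (hc : c ≤ a) {x : F.obj (op b)}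
    {y : F.obj (op a)} (hy : IsLeastExtension F hb x y) {m : F.obj (op c)}
    (hm : res F (inf_le_left : b ⊓ c ≤ b) x ≤ res F inf_le_right m) : res F hc y ≤ m := by
  obtain ⟨z, hz, hz'⟩ :=
    h.exists_isLeastExtension (inf_le_right : b ⊓ c ≤ c) (res F inf_le_left x)
  obtain ⟨w, hwb, hwc⟩ := hF.isSheaf.isSetSheaf.exists_glue_pair le_sup_left le_sup_right le_rfl
    x z hz.symm
  obtain ⟨v, rfl⟩ := h.res_surjective (sup_le hb hc) w
  have hvb : res F hb v = x := (res_res F (sup_le hb hc) le_sup_left v).symm.trans hwb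
  have hvc : res F hc v = z := (res_res F (sup_le hb hc) le_sup_right v).symm.trans hwc
  exact ((res F hc).monotone (hy.2 v hvb.ge)).trans (hvc.le.trans (hz' m hm))

/-- The supremum of a downsheaf `S` of `F^a` is the join in `F(a)` of the least extensions of all
elements of `S`. -/
theorem IsFiberwiseComplete.isCompletePosheaf (h : IsFiberwiseComplete F) (hF : IsPosheaf F) :
    IsCompletePosheaf F := by
  have hex (a : O) (S : DownSheaf F a) : ∃ s, IsLUB {y | ∃ (b : O) (k : b ≤ a) (x : F.obj (op b)),
      x ∈ S.carrier b ∧ IsLeastExtension F k x y} s := h.exists_isLUB a _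
  choose σ hlub using hex
  have hσ (a : O) (S : DownSheaf F a) (z : F.obj (op a)) : σ a S ≤ z ↔ S ≤ principal F hF z := by
    rw [isLUB_le_iff (hlub a S)]
    constructor
    · intro hz b x hx
      obtain ⟨y, hy⟩ := h.exists_isLeastExtension (S.le_of_mem hx) x
      exact ⟨S.le_of_mem hx, hy.1.ge.trans
        ((res F _).monotone (hz ⟨b, S.le_of_mem hx, x, hx, hy⟩))⟩
    · rintro hS y ⟨b, k, x, hx, hy⟩
      exact hy.2 z (hS b hx).2
  have hres {a c : O} (k : c ≤ a) (S : DownSheaf F a) : res F k (σ a S) = σ c S.restrict := by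
    refine le_antisymm ((h.res_isLUB k _ _ (hlub a S)).2 ?_) ((hσ _ _ _).2 ?_)
    · rintro _ ⟨y, ⟨b, l, x, hx, hy⟩, rfl⟩
      refine h.res_le_of_isLeastExtension hF l k hy ?_
      exact ((hσ c S.restrict _).1 le_rfl (b ⊓ c) ⟨S.res_mem inf_le_left hx, inf_le_right⟩).2
    · rintro b x ⟨hx, hb⟩
      have hx' := ((hσ a S _).1 le_rfl b hx).2
      exact ⟨hb, hx'.trans (res_res F k hb _).ge⟩
  refine ⟨hF, { app := fun a => PartOrd.ofHom ⟨σ a.unop, fun S T hST => (hσ _ _ _).2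
      (hST.trans ((hσ _ _ _).1 le_rfl))⟩
                naturality := fun a b k => PartOrd.ext fun S => (hres (leOfHom k.unop) S).symm },
    fun p q => exists_congr fun k => ?_⟩
  have e : (principal F hF q.2).restrict = principal F hF (res F k q.2) :=
    (NatTrans.naturality_apply (principalHom F hF) (homOfLE k).op q.2).symm
  exact (hσ _ _ _).trans
    (iff_of_eq (congrArg (fun T : DownSheaf F p.1 => (p.2 : DownSheaf F p.1) ≤ T) e.symm))

end Complete

/-! ### The equivalence -/

section Equivalence

variable {O : Type u} [Frame O]

/-- For a sheaf `P`, the bijection `s ↦ p_s` from `P(a)` to the sections of `Λ(P)` over `a`. -/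
noncomputable def unitEquiv {P : Oᵒᵖ ⥤ Type u} (hP : IsSetSheaf P) (a : O) :
    P.obj (op a) ≃ Sec ((Lam O).obj P) a :=
  Equiv.ofBijective ((unitHom P).app (op a)) ⟨unitHom_injective hP a, unitHom_surjective hP a⟩

theorem res_projSec (F : OPsh O) {a b : O} (h : b ≤ a) (s : F.obj (op a)) :
    Sec.res h (projSec ((forgetOrder O).obj F) ⟨a, s⟩) =
      projSec ((forgetOrder O).obj F) ⟨b, res F h s⟩ :=
  sec_ext fun (x : LamFrame ((forgetOrder O).obj F)) =>
    (LamFrame.val_res ((forgetOrder O).obj F) x h s).symm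

/-- For a posheaf `F`, the bijection `s ↦ p_s` from `F(a)` to the sections of `Λ(F)` over `a`. -/
noncomputable def secEquiv {F : OPsh O} (hF : IsPosheaf F) (a : O) :
    F.obj (op a) ≃ Sec ((Lam O).obj ((forgetOrder O).obj F)) a :=
  unitEquiv hF.isSheaf.isSetSheaf a

/-- The order on the sections of `Λ(F)` transported from `F(a)`. -/
noncomputable abbrev secOrder {F : OPsh O} (hF : IsPosheaf F) (a : O) :
    PartialOrder (Sec ((Lam O).obj ((forgetOrder O).obj F)) a) :=
  PartialOrder.lift (secEquiv hF a).symm (secEquiv hF a).symm.injective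

/-- `secEquiv` as an order isomorphism for the transported order. -/
noncomputable def secOrderIso {F : OPsh O} (hF : IsPosheaf F) (a : O) :
    letI := secOrder hF a
    F.obj (op a) ≃o Sec ((Lam O).obj ((forgetOrder O).obj F)) a :=
  letI := secOrder hF a
  { secEquiv hF a with
    map_rel_iff' := by
      intro x y
      change (secEquiv hF a).symm (secEquiv hF a x) ≤ (secEquiv hF a).symm (secEquiv hF a y) ↔ _
      rw [Equiv.symm_apply_apply, Equiv.symm_apply_apply] }

/-- `Λ(F)` for a fibrewise complete posheaf `F`: the sections over `a` carry the order of `F(a)`,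
transported along the unit. -/
noncomputable def lamCPOLH (F : OPsh O) (hF : IsPosheaf F) (h : IsFiberwiseComplete F) :
    CPOLH O :=
  letI (a : O) := secOrder hF a
  letI oe (a : O) := secOrderIso hF a
  have hres {a b : O} (k : b ≤ a) (x : F.obj (op a)) :
      Sec.res k (oe a x) = oe b (res F k x) := res_projSec F k x
  have himage {a b : O} (k : b ≤ a) (A : Set (F.obj (op a))) :
      Sec.res k '' (oe a '' A) = oe b '' (res F k '' A) := by
    rw [Set.image_image, Set.image_image]
    exact Set.image_congr' (hres k)
  { toOver := (Lam O).obj ((forgetOrder O).obj F)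
    isLocalHomeo := isLocalHomeo_lam _
    exists_isLUB := fun a A => by
      obtain ⟨s, hs⟩ := h.exists_isLUB a ((oe a).symm '' A)
      exact ⟨oe a s, by simpa [Set.image_image] using (oe a).isLUB_image'.2 hs⟩
    exists_isGLB := fun a A => by
      obtain ⟨s, hs⟩ := h.exists_isGLB a ((oe a).symm '' A)
      exact ⟨oe a s, by simpa [Set.image_image] using (oe a).isGLB_image'.2 hs⟩
    res_surjective := fun {a b} k s => by
      obtain ⟨x, rfl⟩ := (oe b).surjective s
      obtain ⟨y, rfl⟩ := h.res_surjective k x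
      exact ⟨oe a y, hres k y⟩
    res_isLUB := fun {a b} k A s hs => by
      obtain ⟨A, rfl⟩ := (oe a).surjective.image_surjective A
      obtain ⟨s, rfl⟩ := (oe a).surjective s
      rw [hres, himage]
      exact (oe b).isLUB_image'.2 (h.res_isLUB k A s ((oe a).isLUB_image'.1 hs))
    res_isGLB := fun {a b} k A s hs => by
      obtain ⟨A, rfl⟩ := (oe a).surjective.image_surjective A
      obtain ⟨s, rfl⟩ := (oe a).surjective s
      rw [hres, himage]
      exact (oe b).isGLB_image'.2 (h.res_isGLB k A s ((oe a).isGLB_image'.1 hs))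
    le_of_locally := fun ι a s t hst => by
      obtain ⟨s, rfl⟩ := (oe _).surjective s
      obtain ⟨t, rfl⟩ := (oe _).surjective t
      simp only [hres, OrderIso.le_iff_le] at hst ⊢
      exact hF.le_of_locally ι a s t hst }

/-- The unit as an order isomorphism from `F(a)` to the sections of `lamCPOLH F` over `a`. -/
noncomputable def unitOrderIso (F : OPsh O) (hF : IsPosheaf F) (h : IsFiberwiseComplete F)
    (a : O) : F.obj (op a) ≃o Sec (lamCPOLH F hF h).toOver a :=
  secOrderIso hF a

theorem isPosheaf_sections (f : CPOLH O) : IsPosheaf ((CPOLH.sections O).obj f) where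
  isSheaf := isSetSheaf_sections f.toOver
  le_of_locally := f.le_of_locally

theorem isFiberwiseComplete_sections (f : CPOLH O) :
    IsFiberwiseComplete ((CPOLH.sections O).obj f) where
  exists_isLUB := f.exists_isLUB
  exists_isGLB := f.exists_isGLB
  res_surjective := f.res_surjective
  res_isLUB := f.res_isLUB
  res_isGLB := f.res_isGLB

variable (O) in
/-- The functor `Γ` from complete partially ordered sheaf locales to complete posheaves. -/
def gamCPOS : CPOLH O ⥤ CPOS O :=
  (completePosheaf O).lift (CPOLH.sections O) fun f =>
    (isFiberwiseComplete_sections f).isCompletePosheaf (isPosheaf_sections f)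

theorem CPOS.isPosheaf (F : CPOS O) : IsPosheaf F.obj := F.property.choose

theorem CPOS.isFiberwiseComplete (F : CPOS O) : IsFiberwiseComplete F.obj :=
  IsCompletePosheaf.isFiberwiseComplete F.property

variable (O) in
/-- The functor `Λ` from complete posheaves to complete partially ordered sheaf locales. -/
noncomputable def lamFunctor : CPOS O ⥤ CPOLH O where
  obj F := lamCPOLH F.obj F.isPosheaf F.isFiberwiseComplete
  map {F G} α :=
    { hom := (Lam O).map ((CPOS.toPresheaf O).map α)
      mono := fun a s t h => by
        obtain ⟨s, rfl⟩ := (unitOrderIso F.obj F.isPosheaf F.isFiberwiseComplete a).surjective s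
        obtain ⟨t, rfl⟩ := (unitOrderIso F.obj F.isPosheaf F.isFiberwiseComplete a).surjective t
        rw [OrderIso.le_iff_le] at h
        exact (unitOrderIso G.obj G.isPosheaf G.isFiberwiseComplete a).monotone
          ((α.hom.app (op a)).hom.monotone h) }
  map_id F := CPOLH.Hom.ext ((congrArg (Lam O).map ((CPOS.toPresheaf O).map_id F)).trans
    ((Lam O).map_id _))
  map_comp α β := CPOLH.Hom.ext ((congrArg (Lam O).map ((CPOS.toPresheaf O).map_comp α β)).trans
    ((Lam O).map_comp _ _))

/-- The unit at a complete posheaf, as an isomorphism of posheaves. -/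
noncomputable def unitIso (F : CPOS O) : F ≅ (gamCPOS O).obj ((lamFunctor O).obj F) :=
  (completePosheaf O).isoMk <| NatIso.ofComponents
    (fun a => PartOrd.Iso.mk (α := F.obj.obj a)
      (β := ((gamCPOS O).obj ((lamFunctor O).obj F)).obj.obj a)
      (unitOrderIso F.obj F.isPosheaf F.isFiberwiseComplete a.unop))
    fun h => PartOrd.ext fun s => (res_projSec F.obj (leOfHom h.unop) s).symm

/-- The counit at a complete partially ordered sheaf locale, as an isomorphism. -/
noncomputable def counitIso (f : CPOLH O) : (lamFunctor O).obj ((gamCPOS O).obj f) ≅ f :=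
  haveI : IsIso (counitHom f.toOver) := isIso_counitHom f.isLocalHomeo
  letI j : f.toOver ⟶ ((lamFunctor O).obj ((gamCPOS O).obj f)).toOver :=
    (inv (counitHom f.toOver) : f.toOver ⟶ (Lam O).obj ((Gam O).obj f.toOver))
  letI e (a : O) := unitOrderIso ((CPOLH.sections O).obj f) (CPOS.isPosheaf ((gamCPOS O).obj f))
    (CPOS.isFiberwiseComplete ((gamCPOS O).obj f)) a
  { hom :=
      { hom := counitHom f.toOver
        mono := fun a s t h => by
          obtain ⟨s, rfl⟩ := (e a).surjective s
          obtain ⟨t, rfl⟩ := (e a).surjective t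
          exact (e a).le_iff_le.1 h }
    inv :=
      { hom := j
        mono := fun a s t h => by
          have he (r : Sec f.toOver a) : r ≫ j = e a r :=
            (IsIso.comp_inv_eq (counitHom f.toOver)).2 rfl
          exact (he s).le.trans (((e a).monotone h).trans (he t).ge) }
    hom_inv_id := CPOLH.Hom.ext (IsIso.hom_inv_id (counitHom f.toOver))
    inv_hom_id := CPOLH.Hom.ext (IsIso.inv_hom_id (counitHom f.toOver)) }

variable (O) in
/-- The equivalence of `CPOS_X` and `CPOLH/X` given by `Λ` and `Γ`. -/
noncomputable def posheafLocaleEquivalence : CPOS O ≌ CPOLH O where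
  functor := lamFunctor O
  inverse := gamCPOS O
  unitIso := NatIso.ofComponents unitIso fun _ =>
    ObjectProperty.hom_ext _ (NatTrans.ext (funext fun _ => PartOrd.ext fun _ => rfl))
  counitIso := NatIso.ofComponents counitIso fun _ =>
    CPOLH.Hom.ext (Over.OverMorphism.ext (hom_ext fun _ => rfl))
  functor_unitIso_comp _ := CPOLH.Hom.ext (Over.OverMorphism.ext (hom_ext fun _ => rfl))

end Equivalence

end PosheafLocale

open PosheafLocale in
/-- `O` is the frame of opens of the locale `X`. There is an equivalence `CPOS_X ≌ CPOLH/X` whose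
functors lie over `Λ` and over `Γ` (the latter with the orders on sections), and whose unit and
counit lie over the unit `P → ΓΛ(P)` and the counit `ΛΓ(f) → f`. -/
theorem corollary4p4 (O : Type u) [Frame O] :
    ∃ (e : CPOS O ≌ CPOLH O)
      (hLam : e.functor ⋙ CPOLH.forget O = CPOS.toPresheaf O ⋙ Lam O)
      (hGam : e.inverse ⋙ (completePosheaf O).ι = CPOLH.sections O),
      (∀ F : CPOS O,
        (CPOS.toPresheaf O).map (e.unit.app F) ≫
            (forgetOrder O).map ((eqToHom hGam).app (e.functor.obj F)) ≫
              (Gam O).map ((eqToHom hLam).app F) =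
          unitHom ((CPOS.toPresheaf O).obj F)) ∧
      (∀ f : CPOLH O,
        (CPOLH.forget O).map (e.counit.app f) =
          (eqToHom hLam).app (e.inverse.obj f) ≫
            (Lam O).map ((forgetOrder O).map ((eqToHom hGam).app f)) ≫
              counitHom f.toOver) := by
  -- `lamFunctor` and `gamCPOS` lie over `Λ` and `Γ` definitionally, so each `eqToHom` is an identity.
  exact ⟨posheafLocaleEquivalence O, rfl, rfl, fun _ => rfl, fun _ => rfl⟩
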